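/- **Theorem (Noncommutative Herzog–Koh–Lee).** Let $R$ be a complete Noetherian commutative local domain with maximal ideal $\mathfrak m$ and Krull dimension $d$, and let $\Lambda$ be an $R$-algebra (not necessarily commutative) that is finitely generated and torsion-free as an $R$-module. Let $e_1,\dots,e_l$ be a basic set of primitive idempotents of $\Lambda$: pairwise orthogonal primitive idempotents such that every left module $\Lambda f$ with $f$ a primitive idempotent is isomorphic to $\Lambda e_i$ for exactly one $i$. For nonempty $I\subset\{1,\dots,l\}$ put $e_I=\sum_{i\in I}e_i$ and $\Lambda_I=e_I\Lambda e_I$. Choose a maximal $\Lambda_I$-regular sequence $x_1,\dots,x_r\in\mathfrak m$, and let $V_I$ be the right $\Lambda_I$-module $\Lambda_I/\sum_k x_k\Lambda_I$. Let $\operatorname{Soc}(V_I)$ be its largest semisimple submodule, choose an index $c\in I$ with $\operatorname{Soc}(V_I)\otimes_{\Lambda_I}\Lambda_I e_c\neq 0$, and put $$s_I=\inf\{t\ge 1 : \operatorname{Soc}(V_I)\otimes_{\Lambda_I}\Lambda_I e_c\not\subset V_I\mathfrak m^t\otimes_{\Lambda_I}\Lambda_I e_c\},$$ both sides being regarded as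 subgroups of $V_I\otimes_{\Lambda_I}\Lambda_I e_c$. The choices may be made arbitrarily and independently for the different $I$. Let $s=\max\{s_I : \emptyset\ne I\subset\{1,\dots,l\}\}$ (with $s=0$ if $l=0$, that is, if $\Lambda=0$). Let $U$ be a finitely generated left $\Lambda$-module with minimal projective resolution $$P_\bullet:\ \cdots\to P_{j+1}\xrightarrow{\delta_{j+1}}P_j\to\cdots\to P_1\xrightarrow{\delta_1} P_0\ (\to U\to 0).$$ Suppose that for every $0\le j\le l(d+1)$ the map $\delta_{j+1}$ is zero modulo $\mathfrak m^{s}$, that is, $\operatorname{Im}\delta_{j+1}\subset\mathfrak m^{s}P_j$. Then $P_{l(d+1)}=0$; equivalently, $\operatorname{pd}_\Lambda U<l(d+1)$. -/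

import Mathlib

universe u v

/-- A primitive idempotent: a nonzero idempotent which is not a sum of two nonzero orthogonal
idempotents. -/
structure IsPrimitiveIdempotent {A : Type*} [Ring A] (e : A) : Prop where
  idem : IsIdempotentElem e
  ne_zero : e ≠ 0
  indecomposable : ∀ f g : A, IsIdempotentElem f → IsIdempotentElem g →
    f * g = 0 → g * f = 0 → e = f + g → f = 0 ∨ g = 0

/-- A basic set of primitive idempotents: pairwise orthogonal primitive idempotents `e i` such
that the left ideals `A (e i)` form an irredundant set of representatives of the isomorphism
classes of the left modules `A f`, for `f` a primitive idempotent. (For a ring `A`,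
`Ideal.span {f}` is the left ideal `A f`.) -/
structure IsBasicSet {A : Type*} [Ring A] {ι : Type*} (e : ι → A) : Prop where
  ortho : OrthogonalIdempotents e
  primitive : ∀ i, IsPrimitiveIdempotent (e i)
  irredundant : ∀ i j, Nonempty (Ideal.span {e i} ≃ₗ[A] Ideal.span {e j}) → i = j
  complete : ∀ f : A, IsPrimitiveIdempotent f →
    ∃ i, Nonempty (Ideal.span {f} ≃ₗ[A] Ideal.span {e i})

section CornerAlgebra

variable {R : Type*} [CommRing R] {A : Type*} [Ring A] [Algebra R A] {ε : A}

/-- The `R`-module structure of the corner ring `ε A ε`, inherited from `A`. -/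
instance cornerModule (hε : IsIdempotentElem ε) : Module R hε.Corner where
  smul r a := ⟨r • a.1, (Subsemigroup.mem_corner_iff hε).2 <| by
    have h := (Subsemigroup.mem_corner_iff hε).1 a.2
    rw [mul_smul_comm, smul_mul_assoc, h.1, h.2]
    exact ⟨rfl, rfl⟩⟩
  one_smul a := Subtype.ext (one_smul R a.1)
  mul_smul r t a := Subtype.ext (mul_smul r t a.1)
  smul_zero r := Subtype.ext (smul_zero r)
  smul_add r a b := Subtype.ext (smul_add r a.1 b.1)
  add_smul r t a := Subtype.ext (add_smul r t a.1)
  zero_smul a := Subtype.ext (zero_smul R a.1)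

/-- The corner ring `ε A ε` of an `R`-algebra `A` is an `R`-algebra. -/
instance cornerAlgebra (hε : IsIdempotentElem ε) : Algebra R hε.Corner :=
  Algebra.ofModule (fun r a b => Subtype.ext (smul_mul_assoc r a.1 b.1))
    (fun r a b => Subtype.ext (mul_smul_comm r a.1 b.1))

end CornerAlgebra

section SubsetCorner

variable {A : Type*} [Ring A] {ι : Type*} {e : ι → A}

theorem OrthogonalIdempotents.sum_isIdempotent (he : OrthogonalIdempotents e) (I : Finset ι) :
    IsIdempotentElem (∑ i ∈ I, e i) := by
  classical
  exact he.isIdempotentElem_sum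

/-- The ring `A_I = (∑_{i ∈ I} e i) A (∑_{i ∈ I} e i)`. -/
abbrev OrthogonalIdempotents.CornerRing (he : OrthogonalIdempotents e) (I : Finset ι) : Type _ :=
  (he.sum_isIdempotent I).Corner

/-- The idempotents `e i`, for `i ∈ I`, as elements of `A_I`. -/
def OrthogonalIdempotents.cornerFamily (he : OrthogonalIdempotents e) (I : Finset ι) (i : I) :
    he.CornerRing I :=
  ⟨e i, (Subsemigroup.mem_corner_iff (he.sum_isIdempotent I)).2 <| by
    classical
    constructor
    · rw [Finset.sum_mul, Finset.sum_eq_single i.1 (fun j _ hj => he.ortho hj)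
        (fun h => absurd i.2 h), (he.idem i.1).eq]
    · rw [Finset.mul_sum, Finset.sum_eq_single i.1 (fun j _ hj => he.ortho hj.symm)
        (fun h => absurd i.2 h), (he.idem i.1).eq]⟩

end SubsetCorner

section Socle

/-- The socle of a module: its largest semisimple submodule. -/
def socle (B : Type*) [Ring B] (V : Type*) [AddCommGroup V] [Module B V] : Submodule B V :=
  sSup {N : Submodule B V | IsSemisimpleModule B N}

variable (R : Type*) [CommRing R] [IsLocalRing R] (A : Type*) [Ring A] [Algebra R A]

/-- `x` is a maximal `A`-regular sequence in the maximal ideal of `R`. -/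
def IsMaximalRegularSequence (x : List R) : Prop :=
  (∀ r ∈ x, r ∈ IsLocalRing.maximalIdeal R) ∧ RingTheory.Sequence.IsRegular A x ∧
    ∀ y ∈ IsLocalRing.maximalIdeal R, ¬ RingTheory.Sequence.IsRegular A (x ++ [y])

/-- The right ideal `∑ xᵢ A`. Right `A`-modules are modules over `Aᵐᵒᵖ`. -/
def seqRightIdeal (x : List R) : Submodule Aᵐᵒᵖ A :=
  Submodule.span Aᵐᵒᵖ {a : A | ∃ r ∈ x, a = algebraMap R A r}

/-- The right `A`-module `V = A / ∑ xᵢ A`. -/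
abbrev SeqQuotient (x : List R) : Type _ := A ⧸ seqRightIdeal R A x

/-- Right multiplication `v ↦ v a` on `V = A / ∑ xᵢ A`, as an `R`-linear map. -/
def seqQuotientMulRight (x : List R) (a : A) : SeqQuotient R A x →ₗ[R] SeqQuotient R A x :=
  Algebra.lsmul R R (SeqQuotient R A x) (MulOpposite.op a)

variable {A}

/-- `s` is a value of the number `s_A` of the `R`-algebra `A` with basic idempotents `e i`: for
some maximal regular sequence `x` on `A`, with `V = A / ∑ xᵢ A`, and for some index `i` with
`Soc(V) ⊗_A A(e i) ≠ 0`, the number `s` is the least `t ≥ 1` for which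
`Soc(V) ⊗_A A(e i)` is not contained in `V𝔪ᵗ ⊗_A A(e i)`. For a right submodule `W` of `V`, the
subgroup `W ⊗_A A(e i)` of `V ⊗_A A(e i)` is written as the subgroup `W (e i)` of `V (e i)`, by the
canonical isomorphism `v ⊗ a (e i) ↦ v a (e i)`. -/
def IsSocleNumber {ι : Type*} (e : ι → A) (s : ℕ) : Prop :=
  ∃ (x : List R) (i : ι), IsMaximalRegularSequence R A x ∧
    (∃ v ∈ socle Aᵐᵒᵖ (SeqQuotient R A x), seqQuotientMulRight R A x (e i) v ≠ 0) ∧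
    s = sInf {t : ℕ | 1 ≤ t ∧ ∃ v ∈ socle Aᵐᵒᵖ (SeqQuotient R A x),
      seqQuotientMulRight R A x (e i) v ∉
        (IsLocalRing.maximalIdeal R ^ t • (⊤ : Submodule R (SeqQuotient R A x))).map
          (seqQuotientMulRight R A x (e i))}

end Socle

section MinimalResolution

/-- A submodule `N` of `M` is superfluous if `N + K = M` implies `K = M`. -/
def IsSuperfluousSubmodule {A : Type*} [Ring A] {M : Type*} [AddCommGroup M] [Module A M]
    (N : Submodule A M) : Prop :=
  ∀ K : Submodule A M, N ⊔ K = ⊤ → K = ⊤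

/-- `⋯ → P 2 → P 1 → P 0 → U → 0` is a minimal projective resolution of `U` by finitely generated
modules: it is exact, every `P n` is projective and finitely generated, and `P 0 → U` and each
`P (n + 1) → Im(P (n + 1) → P n)` are projective covers, i.e. have superfluous kernel.
The map `δ n : P (n + 1) → P n` is the differential usually called `δ_{n+1}`. -/
structure IsMinimalProjectiveResolution {A : Type*} [Ring A] {U : Type*} [AddCommGroup U]
    [Module A U] {P : ℕ → Type*} [∀ n, AddCommGroup (P n)] [∀ n, Module A (P n)]
    (π : P 0 →ₗ[A] U) (δ : ∀ n, P (n + 1) →ₗ[A] P n) : Prop where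
  projective : ∀ n, Module.Projective A (P n)
  finite : ∀ n, Module.Finite A (P n)
  surjective : Function.Surjective π
  exact_zero : Function.Exact (δ 0) π
  exact_succ : ∀ n, Function.Exact (δ (n + 1)) (δ n)
  superfluous_zero : IsSuperfluousSubmodule (LinearMap.ker π)
  superfluous_succ : ∀ n, IsSuperfluousSubmodule (LinearMap.ker (δ n))

end MinimalResolution

/-!
The argument is elementary: every tensor product and `Tor` over `Λ_I` is replaced by reduction modulo
a sequence in `R`.

Say that `Λ e_i` occurs in a projective module if it is a direct summand. It suffices to show that
in each `d + 1` consecutive degrees one of the idempotents disappears from the resolution: after `l`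
rounds none is left and the term in degree `l (d + 1)` vanishes. At the outset all `e_i` together
suffice, because `1` lies in the two-sided ideal they generate
(`IsBasicSet.idempotentSpan_eq_top`).

Suppose that in degrees from `a` up to `l (d + 1)` only the `Λ e_i` with `i ∈ I` occur, put
`ε = e_I`, and let `x = (x_1, …, x_r)` be the sequence and `c ∈ I` the index chosen for `I`. The `x_k` are central, so
they form a weakly regular sequence on each `ε P_n` as well
(`mem_smul_top_of_isSMulRegular_corner`). Since `ε P` is exact, `ε P / x ε P` is therefore exact from
degree `a + r + 1` on, and so from degree `a + d + 1` on, because `r ≤ d`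
(`exists_sub_mem_smul_top_of_isWeaklyRegular_corner`, `RingTheory.Sequence.IsRegular.length_le`).
The socle of `V_I` is annihilated by `𝔪` (`maximalIdeal_smul_eq_zero_of_mem_socle`), and the
differentials have image in `𝔪 ^ s P` with `s ≥ 1`. Thus, for `v ∈ Λ_I` representing a socle element
and `p ∈ ε P_n`, the element `v p` is a cycle modulo `x`, hence a boundary modulo `x`, hence in
`𝔪 ^ s P_n + x P_n`. If `Λ e_c` occurred in `P_n`, the projection onto it would give
`v e_c ∈ 𝔪 ^ s Λ_I e_c + x Λ_I` for all such `v`, contrary to `s ≥ s_I`. So `Λ e_c` does not occur in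
degrees from `a + d + 1` up to `l (d + 1)` (`exists_idempotentSpan_erase_eq_top`).

That the remaining idempotents then generate `P_n` (`exists_dual_eq_idempotent`) uses that
`e_c Λ e_c` is local. This is where completeness of `R` enters, by lifting idempotents
(`isUnit_of_forall_pow_notMem`).
-/

open IsLocalRing

/-! ### Fitting's lemma over a complete local ring -/

/-- For a finite module `M` the map from `M ⊗ R̂` to the completion of `M` is surjective, and `R̂` is
the image of `R`. -/
theorem IsAdicComplete.isPrecomplete_of_finite {R : Type*} [CommRing R] (I : Ideal R)
    [IsAdicComplete I R] (M : Type*) [AddCommGroup M] [Module R M] [Module.Finite R M] :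
    IsPrecomplete I M := by
  rw [← AdicCompletion.of_surjective_iff]
  intro y
  obtain ⟨t, rfl⟩ := AdicCompletion.ofTensorProduct_surjective_of_finite I M y
  induction t using TensorProduct.induction_on with
  | zero => exact ⟨0, by simp⟩
  | tmul r m =>
    obtain ⟨a, rfl⟩ := AdicCompletion.of_surjective I R r
    refine ⟨a • m, ?_⟩
    rw [AdicCompletion.ofTensorProduct_tmul, map_smul]
    ext n
    simp
    rfl
  | add x y hx hy =>
    obtain ⟨a, ha⟩ := hx
    obtain ⟨b, hb⟩ := hy
    exact ⟨a + b, by rw [map_add, map_add, ha, hb]⟩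

/-- Idempotents lift modulo the ideal of a Henselian pair. -/
theorem HenselianRing.exists_isIdempotentElem {C : Type*} [CommRing C] (I : Ideal C)
    [HenselianRing C I] (f : C) (hf : f * f - f ∈ I) :
    ∃ g : C, IsIdempotentElem g ∧ g - f ∈ I := by
  nontriviality C
  obtain ⟨g, hg, hgf⟩ := HenselianRing.is_henselian (I := I)
    (Polynomial.X ^ 2 - Polynomial.X : Polynomial C) (by monicity!) f
    (by simpa [sq] using hf) (by
      -- the derivative `2 f - 1` squares to `1` modulo `I`
      refine IsUnit.of_mul_eq_one (Ideal.Quotient.mk I (2 * f - 1)) ?_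
      rw [← map_mul, ← map_one (Ideal.Quotient.mk I), Ideal.Quotient.eq]
      have : (Polynomial.derivative (Polynomial.X ^ 2 - Polynomial.X : Polynomial C)).eval f
          = 2 * f - 1 := by simp [one_add_one_eq_two]
      rw [this]
      have h4 : (2 * f - 1) * (2 * f - 1) - 1 = 4 * (f * f - f) := by ring
      rw [h4]
      exact I.mul_mem_left _ hf)
  refine ⟨g, ?_, hgf⟩
  have : g ^ 2 - g = 0 := by simpa [Polynomial.IsRoot] using hg
  rw [IsIdempotentElem, ← sq]
  exact sub_eq_zero.1 this

/-- Fitting's lemma for a commutative ring with only trivial idempotents: modulo `I` the ideals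
`(a ^ n)` stabilize to an idempotent ideal, whose idempotent generator lifts to `0` or `1`. -/
theorem isUnit_or_pow_mem_of_trivial_idempotents {C : Type*} [CommRing C] (I : Ideal C)
    [HenselianRing C I] [IsArtinianRing (C ⧸ I)]
    (hC : ∀ f : C, IsIdempotentElem f → f = 0 ∨ f = 1) (a : C) :
    IsUnit a ∨ ∃ n, a ^ n ∈ I := by
  have hI : I ≤ Ideal.jacobson ⊥ := HenselianRing.jac
  set b : C ⧸ I := Ideal.Quotient.mk I a with hb
  obtain ⟨n, hn⟩ := IsArtinian.monotone_stabilizes (R := C ⧸ I) (M := C ⧸ I)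
    ⟨fun n => OrderDual.toDual (Ideal.span {b ^ n}), fun m n hmn =>
      Ideal.span_singleton_le_span_singleton.2 (pow_dvd_pow b hmn)⟩
  replace hn : ∀ m, n ≤ m → Ideal.span {b ^ n} = Ideal.span {b ^ m} := hn
  have hidem : IsIdempotentElem (Ideal.span {b ^ n}) := by
    rw [IsIdempotentElem, Ideal.span_singleton_mul_span_singleton, ← pow_add]
    exact (hn _ (by omega)).symm
  obtain ⟨f, hf, hfn⟩ := (Ideal.isIdempotentElem_iff_of_fg _ ⟨{b ^ n}, by simp⟩).1 hidem
  obtain ⟨f, rfl⟩ := Ideal.Quotient.mk_surjective f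
  obtain ⟨g, hg, hgf⟩ := HenselianRing.exists_isIdempotentElem I f (by
    rw [← Ideal.Quotient.eq, map_mul]; exact hf)
  rw [← Ideal.Quotient.eq] at hgf
  rcases hC g hg with rfl | rfl
  · right
    refine ⟨n, ?_⟩
    rw [← Ideal.Quotient.eq_zero_iff_mem, map_pow, ← hb, ← Ideal.span_singleton_eq_bot, hfn,
      ← hgf]
    simp
  · left
    have h1 : Ideal.span {b ^ n} = ⊤ := by rw [hfn, ← hgf]; simp
    have h2 : IsUnit b := by
      rw [hn (n + 1) (by omega), Ideal.span_singleton_eq_top] at h1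
      exact isUnit_of_dvd_unit (dvd_pow_self b (by omega)) h1
    exact (isLocalHom_of_le_jacobson_bot I hI).map_nonunit a h2

/-- Fitting's lemma for a finite algebra over a complete local ring. If `0` and `1` are the only
idempotents, then an element is invertible as soon as none of its powers vanishes modulo the
maximal ideal. -/
theorem isUnit_of_forall_pow_notMem {R : Type*} [CommRing R] [IsLocalRing R] [IsNoetherianRing R]
    [IsAdicComplete (maximalIdeal R) R] {B : Type*} [Ring B] [Algebra R B] [Module.Finite R B]
    (hB : ∀ f : B, IsIdempotentElem f → f = 0 ∨ f = 1) (a : B)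
    (ha : ∀ n : ℕ, a ^ n ∉ maximalIdeal R • (⊤ : Submodule R B)) : IsUnit a := by
  let C := Algebra.adjoin R {a}
  have : IsMulCommutative C := Algebra.isMulCommutative_adjoin R (by simp)
  have : Module.Finite R C := inferInstanceAs (Module.Finite R (Subalgebra.toSubmodule C))
  set I : Ideal C := (maximalIdeal R).map (algebraMap R C) with hI
  have : IsPrecomplete I C := IsPrecomplete.map_algebraMap_iff.2
    (IsAdicComplete.isPrecomplete_of_finite _ C)
  have : IsHausdorff I C := IsHausdorff.map_algebraMap_iff.2 inferInstance
  have : IsAdicComplete I C := {}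
  have : IsArtinianRing (C ⧸ I) := by
    have : Module.Finite (R ⧸ maximalIdeal R) (C ⧸ I) :=
      Module.Finite.of_restrictScalars_finite R _ _
    let : Field (R ⧸ maximalIdeal R) := Ideal.Quotient.field _
    exact IsArtinianRing.of_finite (R ⧸ maximalIdeal R) _
  let a' : C := ⟨a, Algebra.self_mem_adjoin_singleton R a⟩
  have hC : ∀ f : C, IsIdempotentElem f → f = 0 ∨ f = 1 := fun f hf => by
    rcases hB f (congrArg Subtype.val hf) with h | h
    · exact Or.inl (Subtype.ext h)
    · exact Or.inr (Subtype.ext h)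
  rcases isUnit_or_pow_mem_of_trivial_idempotents I hC a' with h | ⟨n, hn⟩
  · exact h.map C.val
  · refine absurd ?_ (ha n)
    have h1 : a' ^ n ∈ maximalIdeal R • (⊤ : Submodule R C) := by
      rw [Ideal.smul_top_eq_map]
      exact hn
    have h2 := Submodule.mem_map_of_mem (f := C.val.toLinearMap) h1
    rw [Submodule.map_smul''] at h2
    exact Submodule.smul_mono le_rfl le_top h2

/-! ### Generation by idempotents -/

/-- In a Noetherian ring every idempotent is a finite sum of primitive ones, here in the form of an
induction principle. -/
theorem IsIdempotentElem.mem_of_forall_isPrimitiveIdempotent_mem {A : Type*} [Ring A]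
    [IsNoetherianRing A] (T : AddSubmonoid A) (hT : ∀ f : A, IsPrimitiveIdempotent f → f ∈ T)
    {f : A} (hf : IsIdempotentElem f) : f ∈ T := by
  by_contra hfT
  -- a counterexample `f` for which `A (1 - f)` is maximal is primitive
  obtain ⟨_, ⟨f, ⟨hf, hfT⟩, rfl⟩, hmax⟩ := set_has_maximal_iff_noetherian.2 ‹IsNoetherianRing A›
    ((fun f : A => Ideal.span {1 - f}) '' {f | IsIdempotentElem f ∧ f ∉ T}) ⟨_, f, ⟨hf, hfT⟩, rfl⟩
  have key : ∀ g h : A, IsIdempotentElem g → g * h = 0 → h * g = 0 → f = g + h → h ≠ 0 →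
      g ∈ T := by
    intro g h hg hgh hhg hfgh h0
    by_contra hgT
    refine hmax _ ⟨g, ⟨hg, hgT⟩, rfl⟩ (lt_of_le_not_ge ?_ fun hle => h0 ?_)
    · rw [Ideal.span_singleton_le_iff_mem, Ideal.mem_span_singleton']
      exact ⟨1 - f, by rw [hfgh, mul_sub, mul_one, sub_mul, add_mul, hg.eq, hhg]; simp⟩
    · have h1 : 1 - g ∈ Ideal.span {1 - f} := hle (Ideal.mem_span_singleton_self _)
      obtain ⟨a, ha⟩ := Ideal.mem_span_singleton'.1 h1
      calc h = (1 - g) * f := by rw [hfgh, sub_mul, mul_add g, hg.eq, hgh]; simp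
        _ = 0 := by rw [← ha, mul_assoc, sub_mul, hf.eq]; simp
  refine hfT (hT f ⟨hf, fun h => hfT (h ▸ T.zero_mem), fun g h hg hh hgh hhg hfgh => ?_⟩)
  by_contra! hne
  refine hfT (hfgh ▸ T.add_mem (key g h hg hgh hhg hfgh hne.2) ?_)
  exact key h g hh hhg hgh (by rw [hfgh, add_comm]) hne.1

/-- The submodule `∑_{i ∈ I} A (e i) M` of a left module `M`. It is all of a projective module `M`
exactly when `M` is a summand of a direct sum of copies of the modules `A (e i)`, `i ∈ I`. -/
def idempotentSpan {A : Type*} [Ring A] {ι : Type*} (e : ι → A) (I : Finset ι) (M : Type*)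
    [AddCommGroup M] [Module A M] : Submodule A M :=
  Submodule.span A {m | ∃ i ∈ I, e i • m = m}

/-- The isomorphisms `A f ≅ A (e i)` place every primitive idempotent `f`, and hence `1`, in the
two-sided ideal generated by the `e i`. -/
theorem IsBasicSet.idempotentSpan_eq_top {A : Type*} [Ring A] [IsNoetherianRing A] {ι : Type*}
    [Fintype ι] {e : ι → A} (he : IsBasicSet e) (M : Type*) [AddCommGroup M] [Module A M] :
    idempotentSpan e Finset.univ M = ⊤ := by
  refine eq_top_iff.2 fun m _ => ?_
  let T : Ideal A := (idempotentSpan e Finset.univ M).comap (LinearMap.toSpanSingleton A M m)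
  have h1 : (1 : A) ∈ T.toAddSubmonoid := by
    refine IsIdempotentElem.mem_of_forall_isPrimitiveIdempotent_mem _ (fun f hf => ?_) .one
    obtain ⟨i, ⟨ψ⟩⟩ := he.complete f hf
    let f' : Ideal.span {f} := ⟨f, Ideal.mem_span_singleton_self f⟩
    let e' : Ideal.span {e i} := ⟨e i, Ideal.mem_span_singleton_self _⟩
    obtain ⟨w, hw⟩ := Ideal.mem_span_singleton'.1 (ψ f').2
    have h2 : f = w * (e i * (ψ.symm e').1) := by
      have h3 : ψ f' = (w * e i) • e' := Subtype.ext (by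
        rw [← hw]
        simp [e', mul_assoc, (he.ortho.idem i).eq])
      have h4 := congrArg Subtype.val (congrArg ψ.symm h3)
      rw [map_smul, ψ.symm_apply_apply] at h4
      simpa [f', mul_assoc] using h4
    have h5 : f • m ∈ idempotentSpan e Finset.univ M := by
      rw [h2, mul_smul]
      refine Submodule.smul_mem _ _ (Submodule.subset_span ⟨i, Finset.mem_univ i, ?_⟩)
      rw [smul_smul, ← mul_assoc, (he.ortho.idem i).eq]
    exact h5
  simpa [T] using h1

/-! ### Finite modules over a Noetherian local ring -/

section Local

variable {R : Type*} [CommRing R] [IsLocalRing R] [IsNoetherianRing R]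

/-- Multiplication by `y ∈ 𝔪` on a semisimple module splits off its own image, which vanishes by
Nakayama's lemma. -/
theorem IsSemisimpleModule.maximalIdeal_smul_eq_zero {A : Type*} [Ring A] [Algebra R A]
    {M : Type*} [AddCommGroup M] [Module R M] [Module A M] [IsScalarTower R A M]
    [Module.Finite R M] [IsSemisimpleModule A M] {y : R} (hy : y ∈ maximalIdeal R) (m : M) :
    y • m = 0 := by
  have : SMulCommClass R A M := IsScalarTower.to_smulCommClass
  let f : M →ₗ[A] M := DistribSMul.toLinearMap A M y
  have hf : ∀ m, f m = y • m := fun m => rfl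
  obtain ⟨N, hN⟩ := exists_isCompl (LinearMap.range f)
  have hle : (LinearMap.range f).restrictScalars R ≤
      maximalIdeal R • (LinearMap.range f).restrictScalars R := by
    rintro _ ⟨m, rfl⟩
    obtain ⟨t, ht, n, hn, rfl⟩ := Submodule.mem_sup.1
      (hN.sup_eq_top ▸ Submodule.mem_top : m ∈ LinearMap.range f ⊔ N)
    have h0 : f n = 0 := (Submodule.mem_bot A).1 <| hN.inf_eq_bot ▸
      ⟨⟨n, rfl⟩, by rw [hf, ← algebraMap_smul A y n]; exact N.smul_mem _ hn⟩
    rw [map_add, h0, add_zero]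
    exact Submodule.smul_mem_smul hy ht
  have hbot := Submodule.eq_bot_of_le_smul_of_le_jacobson_bot _ _ (IsNoetherian.noetherian _) hle
    (maximalIdeal_le_jacobson _)
  have : f m ∈ (LinearMap.range f).restrictScalars R := ⟨m, rfl⟩
  rw [hbot] at this
  exact (Submodule.mem_bot R).1 this

theorem maximalIdeal_smul_eq_zero_of_mem_socle {A : Type*} [Ring A] [Algebra R A]
    {M : Type*} [AddCommGroup M] [Module R M] [Module A M] [IsScalarTower R A M]
    [Module.Finite R M] {y : R} (hy : y ∈ maximalIdeal R) {m : M} (hm : m ∈ socle A M) :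
    y • m = 0 := by
  have : SMulCommClass R A M := IsScalarTower.to_smulCommClass
  suffices h : socle A M ≤ LinearMap.ker (DistribSMul.toLinearMap A M y) from h hm
  refine sSup_le fun N (hN : IsSemisimpleModule A N) n hn => ?_
  have : Module.Finite R N := inferInstanceAs (Module.Finite R (N.restrictScalars R))
  exact congrArg Subtype.val 
    (IsSemisimpleModule.maximalIdeal_smul_eq_zero (A := A) hy (⟨n, hn⟩ : N))

/-- A regular sequence on a finite module has at most `dim R` members. -/
theorem RingTheory.Sequence.IsRegular.length_le {M : Type*} [AddCommGroup M] [Module R M]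
    [Module.Finite R M] {x : List R} (hx : RingTheory.Sequence.IsRegular M x) {d : ℕ}
    (hd : ringKrullDim R = d) : x.length ≤ d := by
  have h1 := Module.supportDim_add_length_eq_supportDim_of_isRegular x hx
  have h2 := Module.supportDim_le_ringKrullDim R M
  have := hx.quot_ofList_smul_nontrivial ⊤
  have h3 : 0 ≤ Module.supportDim R (M ⧸ Ideal.ofList x • (⊤ : Submodule R M)) :=
    WithBot.bot_lt_iff_ne_bot.2 (Module.supportDim_ne_bot_of_nontrivial R _) |> Order.succ_le_of_lt
  rw [← h1, hd] at h2
  exact_mod_cast (le_add_of_nonneg_left h3).trans h2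

end Local

/-! ### Corner rings and projective modules -/

/-- The dual basis of a projective module with respect to a spanning set. -/
theorem Module.Projective.exists_dualBasis {A : Type*} [Ring A] {M : Type*} [AddCommGroup M]
    [Module A M] [Module.Projective A M] {S : Set M} (hS : Submodule.span A S = ⊤) :
    ∃ σ : M →ₗ[A] (S →₀ A), ∀ m, Finsupp.linearCombination A ((↑) : S → M) (σ m) = m := by
  obtain ⟨σ, hσ⟩ := Module.projective_lifting_property
    (Finsupp.linearCombination A ((↑) : S → M)) LinearMap.id (by
      rw [← LinearMap.range_eq_top, Finsupp.range_linearCombination, Subtype.range_coe, hS])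
  exact ⟨σ, fun m => LinearMap.congr_fun hσ m⟩

section Corner

variable {R : Type*} [CommRing R] {A : Type*} [Ring A] [Algebra R A] {ε : A}

/-- The inclusion of the corner ring `ε A ε` into `A`. -/
def cornerInclusion (hε : IsIdempotentElem ε) : hε.Corner →ₗ[R] A where
  toFun a := a.1
  map_add' _ _ := rfl
  map_smul' _ _ := rfl

/-- The Peirce projection `a ↦ ε a ε` of `A` onto the corner ring `ε A ε`. -/
def cornerProjection (hε : IsIdempotentElem ε) : A →ₗ[R] hε.Corner where
  toFun a := ⟨ε * a * ε, (Subsemigroup.mem_corner_iff hε).2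
    ⟨by rw [← mul_assoc, ← mul_assoc, hε.eq], by rw [mul_assoc, hε.eq]⟩⟩
  map_add' a b := Subtype.ext (by
    change ε * (a + b) * ε = ε * a * ε + ε * b * ε
    rw [mul_add, add_mul])
  map_smul' r a := Subtype.ext (by
    change ε * (r • a) * ε = r • (ε * a * ε)
    rw [mul_smul_comm, smul_mul_assoc])

theorem cornerProjection_coe (hε : IsIdempotentElem ε) (a : A) :
    (cornerProjection (R := R) hε a).1 = ε * a * ε := rfl

theorem mul_corner_coe (hε : IsIdempotentElem ε) (a : hε.Corner) : ε * a.1 = a.1 :=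
  ((Subsemigroup.mem_corner_iff hε).1 a.2).1

theorem corner_coe_mul (hε : IsIdempotentElem ε) (a : hε.Corner) : a.1 * ε = a.1 :=
  ((Subsemigroup.mem_corner_iff hε).1 a.2).2

theorem Submodule.map_mem_smul_top {M N : Type*} [AddCommGroup M] [Module R M] [AddCommGroup N]
    [Module R N] (f : M →ₗ[R] N) {𝔞 : Ideal R} {m : M} (hm : m ∈ 𝔞 • (⊤ : Submodule R M)) :
    f m ∈ 𝔞 • (⊤ : Submodule R N) := by
  have h := Submodule.mem_map_of_mem (f := f) hm
  rw [Submodule.map_smul''] at h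
  exact Submodule.smul_mono le_rfl le_top h

/-- A linear map over an `R`-algebra, regarded over `R`, maps `𝔞 M` into `𝔞 N`. -/
theorem LinearMap.map_mem_smul_top_of_isScalarTower {M N : Type*} [AddCommGroup M] [Module R M]
    [Module A M] [IsScalarTower R A M] [AddCommGroup N] [Module R N] [Module A N]
    [IsScalarTower R A N] (f : M →ₗ[A] N) {𝔞 : Ideal R} {m : M}
    (hm : m ∈ 𝔞 • (⊤ : Submodule R M)) : f m ∈ 𝔞 • (⊤ : Submodule R N) :=
  Submodule.map_mem_smul_top (f.restrictScalars R) hm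

theorem Submodule.algebra_smul_mem_smul_top {M : Type*} [AddCommGroup M] [Module R M]
    [Module A M] [IsScalarTower R A M] (a : A) {𝔞 : Ideal R} {m : M}
    (hm : m ∈ 𝔞 • (⊤ : Submodule R M)) : a • m ∈ 𝔞 • (⊤ : Submodule R M) :=
  Submodule.map_mem_smul_top (Algebra.lsmul R R M a) hm

theorem IsPrimitiveIdempotent.corner_eq_zero_or_one (h : IsPrimitiveIdempotent ε)
    (f : h.idem.Corner) (hf : IsIdempotentElem f) : f = 0 ∨ f = 1 := by
  have h1 := mul_corner_coe h.idem f
  have h2 := corner_coe_mul h.idem f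
  have h3 : f.1 * f.1 = f.1 := congrArg Subtype.val hf
  rcases h.indecomposable f.1 (ε - f.1) h3
    (by rw [IsIdempotentElem, mul_sub, sub_mul, sub_mul, h.idem.eq, h1, h2, h3]; simp)
    (by rw [mul_sub, h2, h3, sub_self]) (by rw [sub_mul, h1, h3, sub_self]) (by simp) with h0 | h0
  · exact Or.inl (Subtype.ext h0)
  · exact Or.inr (Subtype.ext (sub_eq_zero.1 h0).symm)

theorem Module.Finite.corner [Module.Finite R A] (hε : IsIdempotentElem ε) :
    Module.Finite R hε.Corner :=
  Module.Finite.of_surjective (cornerProjection (R := R) hε) fun a =>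
    ⟨a.1, Subtype.ext (by rw [cornerProjection_coe, mul_corner_coe, corner_coe_mul])⟩

/-- Regularity of `r` on `ε A ε` modulo `𝔞` passes to `ε M` for a projective module `M` that is
generated by `ε M`. -/
theorem mem_smul_top_of_isSMulRegular_corner {ε : A} (hε : IsIdempotentElem ε) {𝔞 : Ideal R}
    {r : R} (hr : IsSMulRegular (hε.Corner ⧸ (𝔞 • ⊤ : Submodule R hε.Corner)) r) {M : Type*}
    [AddCommGroup M] [Module R M] [Module A M] [IsScalarTower R A M] [Module.Projective A M]
    (hM : Submodule.span A {m : M | ε • m = m} = ⊤) {m : M} (hm : ε • m = m)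
    (hrm : r • m ∈ 𝔞 • (⊤ : Submodule R M)) : m ∈ 𝔞 • (⊤ : Submodule R M) := by
  obtain ⟨σ, hσ⟩ := Module.Projective.exists_dualBasis hM
  rw [← hσ m, Finsupp.linearCombination_apply]
  refine Submodule.sum_mem _ fun t _ => ?_
  let φ : M →ₗ[A] A := Finsupp.lapply t ∘ₗ σ
  have hφm : ε * φ m = φ m := by rw [← smul_eq_mul, ← map_smul, hm]
  have h1 : r • cornerProjection (R := R) hε (φ m) ∈ 𝔞 • (⊤ : Submodule R hε.Corner) := by
    rw [← map_smul, ← LinearMap.map_smul_of_tower]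
    exact Submodule.map_mem_smul_top _ (φ.map_mem_smul_top_of_isScalarTower hrm)
  have h2 : cornerProjection (R := R) hε (φ m) ∈ 𝔞 • (⊤ : Submodule R hε.Corner) := by
    rw [← Submodule.Quotient.mk_eq_zero] at h1 ⊢
    exact hr (by simpa using h1)
  have h3 : ε * φ m * ε ∈ 𝔞 • (⊤ : Submodule R A) :=
    Submodule.map_mem_smul_top (cornerInclusion hε) h2
  have h4 : (ε * φ m * ε) • (t : M) = σ m t • (t : M) := by
    rw [mul_smul, (t.2 : ε • (t : M) = t), hφm]
    rfl
  change σ m t • (t : M) ∈ _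
  rw [← h4]
  exact Submodule.map_mem_smul_top ((LinearMap.toSpanSingleton A M (t : M)).restrictScalars R) h3

end Corner

section Local

variable {R : Type*} [CommRing R] [IsLocalRing R] [IsNoetherianRing R]
  {A : Type*} [Ring A] [Algebra R A] [Module.Finite R A]

/-- If the summands `A (e i)`, `i ∈ I`, suffice to build the projective module `M`, but not without
`A (e c)`, then `A (e c)` is a direct summand of `M`: some `p ∈ (e c) M` and some linear form `φ`
satisfy `φ p (e c) = e c`. The local ring `(e c) A (e c)` enters through Fitting's lemma. -/
theorem exists_dual_eq_idempotent [IsAdicComplete (maximalIdeal R) R] {ι : Type*} [DecidableEq ι]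
    {e : ι → A} {I : Finset ι} {c : ι} (hc : IsPrimitiveIdempotent (e c)) {M : Type*}
    [AddCommGroup M] [Module R M] [Module A M] [IsScalarTower R A M] [Module.Finite A M]
    [Module.Projective A M] (hI : idempotentSpan e I M = ⊤)
    (hIc : idempotentSpan e (I.erase c) M ≠ ⊤) :
    ∃ (p : M) (φ : M →ₗ[A] A), e c • p = p ∧ φ p * e c = e c := by
  have hRM : Module.Finite R M := Module.Finite.trans A M
  obtain ⟨W, hW, hWI⟩ := (eq_top_or_exists_le_coatom (idempotentSpan e (I.erase c) M)).resolve_left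
    hIc
  have hfix : ∀ t : M, (∃ i ∈ I, e i • t = t) → t ∉ W → e c • t = t := by
    rintro t ⟨i, hi, hit⟩ htW
    rcases eq_or_ne i c with rfl | hne
    · exact hit
    · exact absurd (hWI (Submodule.subset_span ⟨i, Finset.mem_erase.2 ⟨hne, hi⟩, hit⟩)) htW
  obtain ⟨σ, hσ⟩ := Module.Projective.exists_dualBasis hI
  obtain ⟨s, hsI, hsW⟩ : ∃ s : M, (∃ i ∈ I, e i • s = s) ∧ s ∉ W := by
    by_contra! hcon
    exact hW.1 (top_le_iff.1 (hI ▸ Submodule.span_le.2 hcon))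
  have hs := hfix s hsI hsW
  obtain ⟨⟨t, htI⟩, htW⟩ : ∃ t, σ s t • (t : M) ∉ W := by
    by_contra! hcon
    refine hsW ?_
    rw [← hσ s, Finsupp.linearCombination_apply]
    exact W.sum_mem fun t _ => hcon t
  have ht := hfix t htI fun h => htW (W.smul_mem _ h)
  let φ : M →ₗ[A] A := Finsupp.lapply ⟨t, htI⟩ ∘ₗ σ
  have hφs : e c * φ s = φ s := by rw [← smul_eq_mul, ← map_smul, hs]
  have hφt : φ s • t ∉ W := htW
  -- modulo the maximal submodule `W`, the nonzero element `φ s • t` generates `t`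
  obtain ⟨w, hw, y, hy⟩ : ∃ w ∈ W, ∃ y : A, w + y • φ s • t = t := by
    have htop : W ⊔ Submodule.span A {φ s • t} = ⊤ :=
      hW.2 _ (left_lt_sup.2 fun h => hφt (h (Submodule.mem_span_singleton_self _)))
    obtain ⟨w, hw, z, hz, hwz⟩ := Submodule.mem_sup.1 (htop ▸ Submodule.mem_top : t ∈ _)
    obtain ⟨y, rfl⟩ := Submodule.mem_span_singleton.1 hz
    exact ⟨w, hw, y, hwz⟩
  let b : hc.idem.Corner := cornerProjection (R := R) hc.idem (y * φ s)
  have hb : b.1 = e c * (y * φ s) * e c := rfl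
  have hbt : ∀ n : ℕ, t - (b ^ n).1 • t ∈ W := by
    intro n
    induction n with
    | zero =>
      rw [pow_zero]
      change t - e c • t ∈ W
      rw [ht, sub_self]
      exact W.zero_mem
    | succ n ih =>
      have h1 : t - b.1 • t = e c • w := by
        have h2 : w = t - y • φ s • t := eq_sub_of_add_eq hy
        rw [h2, smul_sub, ht, hb, mul_smul, ht, mul_smul, mul_smul]
      have h3 : (b ^ (n + 1)).1 = (b ^ n).1 * b.1 := by rw [pow_succ]; rfl
      have h4 : t - (b ^ (n + 1)).1 • t = (t - (b ^ n).1 • t) + (b ^ n).1 • (t - b.1 • t) := by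
        rw [h3, smul_sub, smul_smul]; abel
      rw [h4, h1]
      exact W.add_mem ih (W.smul_mem _ (W.smul_mem _ hw))
  have : IsSimpleModule A (M ⧸ W) := isSimpleModule_iff_isCoatom.2 hW
  have hmW : ∀ m ∈ maximalIdeal R • (⊤ : Submodule R M), m ∈ W := by
    intro m hm
    refine Submodule.smul_induction_on hm (fun r hr m _ => ?_) fun x y => W.add_mem
    rw [← Submodule.Quotient.mk_eq_zero]
    exact IsSemisimpleModule.maximalIdeal_smul_eq_zero (A := A) hr (Submodule.Quotient.mk m : M ⧸ W)
  have := Module.Finite.corner (R := R) hc.idem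
  obtain ⟨u, hu⟩ : IsUnit b := by
    refine isUnit_of_forall_pow_notMem (R := R) hc.corner_eq_zero_or_one b fun n hn => ?_
    have h1 : (b ^ n).1 ∈ maximalIdeal R • (⊤ : Submodule R A) :=
      Submodule.map_mem_smul_top (cornerInclusion hc.idem) hn
    have h2 : (b ^ n).1 • t ∈ W := hmW _
      (Submodule.map_mem_smul_top ((LinearMap.toSpanSingleton A M t).restrictScalars R) h1)
    have h3 : t ∈ W := by simpa using W.add_mem (hbt n) h2
    exact hφt (W.smul_mem _ h3)
  refine ⟨(u⁻¹).1.1 • y • s, φ, ?_, ?_⟩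
  · rw [smul_smul, mul_corner_coe]
  · have h1 : (u⁻¹).1.1 * b.1 = e c := by
      have : (u⁻¹).1 * b = 1 := by rw [← hu]; exact u.inv_mul
      exact congrArg Subtype.val this
    have h2 : (u⁻¹).1.1 * (e c * (y * φ s) * e c) = e c := h1
    rw [map_smul, map_smul, smul_eq_mul, smul_eq_mul]
    rwa [← mul_assoc, ← mul_assoc, corner_coe_mul] at h2

end Local

/-! ### Exactness modulo a regular sequence -/

/-- Let `x` be a weakly regular sequence on `ε A ε` and `P` an exact complex whose terms in the
degrees from `a` to `b` are projective and generated by `ε P n`. Reducing the complex `ε P` modulo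
the first `t` members of `x` preserves exactness in the degrees from `a + t + 1` to `b`: each
further member costs one degree. -/
theorem exists_sub_mem_smul_top_of_isWeaklyRegular_corner {R : Type*} [CommRing R] {A : Type*}
    [Ring A] [Algebra R A] {ε : A} (hε : IsIdempotentElem ε) {x : List R}
    (hx : RingTheory.Sequence.IsWeaklyRegular hε.Corner x) {P : ℕ → Type*}
    [∀ n, AddCommGroup (P n)] [∀ n, Module R (P n)] [∀ n, Module A (P n)]
    [∀ n, IsScalarTower R A (P n)] [∀ n, Module.Projective A (P n)]
    (δ : ∀ n, P (n + 1) →ₗ[A] P n) (hδ : ∀ n, Function.Exact (δ (n + 1)) (δ n)) {a b : ℕ}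
    (hP : ∀ n, a ≤ n → n ≤ b → Submodule.span A {m : P n | ε • m = m} = ⊤)
    {t : ℕ} (ht : t ≤ x.length) {n : ℕ} (han : a + t ≤ n) (hnb : n + 1 ≤ b) {q : P (n + 1)}
    (hq : ε • q = q) (hδq : δ n q ∈ Ideal.ofList (x.take t) • (⊤ : Submodule R (P n))) :
    ∃ q' : P (n + 2),
      q - δ (n + 1) q' ∈ Ideal.ofList (x.take t) • (⊤ : Submodule R (P (n + 1))) := by
  induction t generalizing n with
  | zero =>
    rw [List.take_zero, Ideal.ofList_nil, Submodule.bot_smul] at hδq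
    obtain ⟨q', hq'⟩ := (hδ n q).1 ((Submodule.mem_bot R).1 hδq)
    exact ⟨q', by rw [hq', sub_self]; exact Submodule.zero_mem _⟩
  | succ t ih =>
    obtain ⟨n, rfl⟩ : ∃ m, n = m + 1 := ⟨n - 1, by omega⟩
    set 𝔞 := Ideal.ofList (x.take t)
    set r := x[t]
    have h𝔞 : Ideal.ofList (x.take (t + 1)) = 𝔞 ⊔ Ideal.span {r} := by
      rw [← List.take_append_getElem (by omega : t < x.length), Ideal.ofList_append,
        Ideal.ofList_singleton]
    have hsmul : ∀ (n : ℕ) (m : P n), m ∈ (𝔞 ⊔ Ideal.span {r}) • (⊤ : Submodule R (P n)) ↔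
        ∃ α ∈ 𝔞 • (⊤ : Submodule R (P n)), ∃ m', α + r • m' = m := by
      intro n m
      rw [Submodule.sup_smul, Submodule.ideal_span_singleton_smul, Submodule.mem_sup]
      simp [Submodule.mem_smul_pointwise_iff_exists]
    have hcomm : ∀ (n : ℕ) (m : P n), ε • r • m = r • ε • m := fun n m => by
      rw [← algebraMap_smul A r m, ← algebraMap_smul A r (ε • m), smul_smul, smul_smul,
        Algebra.commutes]
    have hδr : ∀ (n : ℕ) (m : P (n + 1)), δ n (r • m) = r • δ n m := fun n m =>
      (δ n).map_smul_of_tower r m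
    rw [h𝔞] at hδq ⊢
    obtain ⟨α, hα, q₁, hq₁⟩ := (hsmul _ _).1 hδq
    have hεq : ε • α + r • ε • q₁ = δ (n + 1) q := by
      rw [← hcomm, ← smul_add, hq₁, ← map_smul, hq]
    -- `r • δ (ε q₁)` vanishes modulo `𝔞`, hence so does `δ (ε q₁)` by regularity of `r`
    have h1 : r • δ n (ε • q₁) ∈ 𝔞 • (⊤ : Submodule R (P n)) := by
      have h2 : r • δ n (ε • q₁) = - δ n (ε • α) := by
        rw [← hδr, eq_neg_iff_add_eq_zero, add_comm, ← map_add, hεq]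
        exact (hδ n).apply_apply_eq_zero q
      rw [h2]
      exact Submodule.neg_mem _ ((δ n).map_mem_smul_top_of_isScalarTower
        (Submodule.algebra_smul_mem_smul_top ε hα))
    have hεε : ∀ (n : ℕ) (m : P n), ε • ε • m = ε • m := fun n m => by rw [smul_smul, hε.eq]
    have h2 : δ n (ε • q₁) ∈ 𝔞 • (⊤ : Submodule R (P n)) :=
      mem_smul_top_of_isSMulRegular_corner hε (hx.regular_mod_prev t (by omega))
        (hP n (by omega) (by omega)) (by rw [← map_smul, hεε]) h1
    obtain ⟨q₂, hq₂⟩ := ih (by omega) (by omega) (by omega) (hεε _ q₁) h2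
    obtain ⟨q₃, hq₃⟩ := ih (n := n + 1) (q := q - r • ε • q₂) (by omega) (by omega) (by omega)
      (by rw [smul_sub, hcomm, hεε, hq]) (by
        have h3 : δ (n + 1) (q - r • ε • q₂) =
            ε • α + ε • r • (ε • q₁ - δ (n + 1) q₂) := by
          rw [map_sub, ← hεq, hδr, map_smul, hcomm, smul_sub, smul_sub, hεε]
          abel
        rw [h3]
        exact Submodule.add_mem _ (Submodule.algebra_smul_mem_smul_top ε hα)
          (Submodule.algebra_smul_mem_smul_top ε (Submodule.smul_mem _ r hq₂)))
    exact ⟨q₃, (hsmul _ _).2 ⟨_, hq₃, ε • q₂, by abel⟩⟩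

/-! ### Socle numbers -/

section SocleNumber

variable {R : Type*} [CommRing R] {A : Type*} [Ring A] [Algebra R A]

theorem mem_seqRightIdeal_iff (x : List R) (a : A) :
    a ∈ seqRightIdeal R A x ↔ a ∈ Ideal.ofList x • (⊤ : Submodule R A) := by
  constructor
  · intro ha
    refine Submodule.span_induction ?_ (Submodule.zero_mem _)
      (fun _ _ _ _ => Submodule.add_mem _) ?_ ha
    · rintro _ ⟨r, hr, rfl⟩
      rw [Algebra.algebraMap_eq_smul_one]
      exact Submodule.smul_mem_smul (Ideal.subset_span hr) trivial
    · intro c a _ ha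
      exact Submodule.map_mem_smul_top (LinearMap.mulRight R c.unop) ha
  · intro ha
    refine Submodule.smul_induction_on ha (fun r hr a _ => ?_) fun _ _ => Submodule.add_mem _
    refine Submodule.span_induction (fun r hr => ?_) ?_ (fun r t _ _ hr ht => ?_)
      (fun t r _ hr => ?_) hr
    · rw [Algebra.smul_def]
      exact Submodule.smul_mem _ (MulOpposite.op a) (Submodule.subset_span ⟨r, hr, rfl⟩)
    · rw [zero_smul]
      exact Submodule.zero_mem _
    · rw [add_smul]
      exact Submodule.add_mem _ hr ht
    · rw [smul_eq_mul, mul_smul]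
      exact Submodule.smul_of_tower_mem _ t hr

theorem Module.Finite.seqQuotient [Module.Finite R A] (x : List R) :
    Module.Finite R (SeqQuotient R A x) :=
  Module.Finite.of_surjective ((seqRightIdeal R A x).mkQ.restrictScalars R) fun v => by
    obtain ⟨a, rfl⟩ := Submodule.Quotient.mk_surjective (seqRightIdeal R A x) v
    exact ⟨a, rfl⟩

/-- By Krull's intersection theorem the infimum defining a socle number is attained. -/
theorem IsSocleNumber.exists_mem_socle [IsLocalRing R] [IsNoetherianRing R] [Module.Finite R A]
    {ι : Type*} {e : ι → A} {s : ℕ} (hs : IsSocleNumber R e s) :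
    1 ≤ s ∧ ∃ (x : List R) (i : ι), RingTheory.Sequence.IsRegular A x ∧
      ∃ v ∈ socle Aᵐᵒᵖ (SeqQuotient R A x), seqQuotientMulRight R A x (e i) v ∉
        (maximalIdeal R ^ s • (⊤ : Submodule R (SeqQuotient R A x))).map
          (seqQuotientMulRight R A x (e i)) := by
  obtain ⟨x, i, ⟨-, hreg, -⟩, ⟨v₀, hv₀, hv₀i⟩, hs⟩ := hs
  have hfin : Module.Finite R (SeqQuotient R A x) := Module.Finite.seqQuotient x
  suffices hmem : s ∈ {t : ℕ | 1 ≤ t ∧ ∃ v ∈ socle Aᵐᵒᵖ (SeqQuotient R A x),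
      seqQuotientMulRight R A x (e i) v ∉
        (maximalIdeal R ^ t • (⊤ : Submodule R (SeqQuotient R A x))).map
          (seqQuotientMulRight R A x (e i))} from ⟨hmem.1, x, i, hreg, hmem.2⟩
  rw [hs]
  refine Nat.sInf_mem ?_
  have hne : ¬ ∀ t : ℕ, seqQuotientMulRight R A x (e i) v₀ ∈
      (maximalIdeal R ^ t • ⊤ : Submodule R (SeqQuotient R A x)) := fun h => by
    refine hv₀i ((Submodule.mem_bot R).1 ?_)
    rw [← IsHausdorff.iInf_pow_smul (I := maximalIdeal R) (M := SeqQuotient R A x)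
      inferInstance, Submodule.mem_iInf]
    exact h
  obtain ⟨t, ht⟩ := not_forall.1 hne
  refine ⟨t + 1, by omega, v₀, hv₀, fun h => ht ?_⟩
  obtain ⟨w, hw, hwv⟩ := h
  rw [← hwv]
  exact Submodule.smul_mono (Ideal.pow_le_pow_right (Nat.le_succ t)) le_rfl
    (Submodule.map_mem_smul_top _ hw)

/-- The defining property of a socle number `s`, in terms of a lift `v` of a socle element to `A`.
-/
theorem IsSocleNumber.exists_notMem [IsLocalRing R] [IsNoetherianRing R] [Module.Finite R A]
    {ι : Type*} {e : ι → A} {s : ℕ} (hs : IsSocleNumber R e s) :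
    1 ≤ s ∧ ∃ (x : List R) (i : ι) (v : A), RingTheory.Sequence.IsRegular A x ∧
      (∀ y ∈ maximalIdeal R, y • v ∈ Ideal.ofList x • (⊤ : Submodule R A)) ∧
      ∀ w ∈ maximalIdeal R ^ s • (⊤ : Submodule R A),
      ∀ z ∈ Ideal.ofList x • (⊤ : Submodule R A), v * e i ≠ w * e i + z := by
  obtain ⟨hs1, x, i, hreg, v, hv, hvi⟩ := hs.exists_mem_socle
  have hfin : Module.Finite R (SeqQuotient R A x) := Module.Finite.seqQuotient x
  obtain ⟨v, rfl⟩ := Submodule.Quotient.mk_surjective _ v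
  refine ⟨hs1, x, i, v, hreg, fun y hy => ?_, fun w hw z hz h => hvi ?_⟩
  · rw [← mem_seqRightIdeal_iff, ← Submodule.Quotient.mk_eq_zero]
    exact maximalIdeal_smul_eq_zero_of_mem_socle hy hv
  · refine ⟨Submodule.Quotient.mk w, Submodule.map_mem_smul_top
      ((seqRightIdeal R A x).mkQ.restrictScalars R) hw, ?_⟩
    change (Submodule.Quotient.mk (w * e i) : SeqQuotient R A x) =
      Submodule.Quotient.mk (v * e i)
    rw [h, eq_comm, Submodule.Quotient.eq, add_sub_cancel_left, mem_seqRightIdeal_iff]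
    exact hz

end SocleNumber

/-! ### Eliminating one idempotent -/

section Sums

variable {A : Type*} [Ring A] {ι : Type*} {e : ι → A}

theorem OrthogonalIdempotents.sum_mul_of_mem (he : OrthogonalIdempotents e) {I : Finset ι} {i : ι}
    (hi : i ∈ I) : (∑ j ∈ I, e j) * e i = e i := by
  rw [Finset.sum_mul, Finset.sum_eq_single i (fun j _ hj => he.ortho hj) (absurd hi),
    (he.idem i).eq]

theorem OrthogonalIdempotents.span_fixed_eq_top (he : OrthogonalIdempotents e) {I : Finset ι}
    {M : Type*} [AddCommGroup M] [Module A M] (hM : idempotentSpan e I M = ⊤) :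
    Submodule.span A {m : M | (∑ i ∈ I, e i) • m = m} = ⊤ := by
  refine top_le_iff.1 (hM ▸ Submodule.span_mono ?_)
  rintro m ⟨i, hi, him⟩
  rw [Set.mem_ofPred_eq, ← him, smul_smul, he.sum_mul_of_mem hi]

end Sums

/-- One round of the argument. If the terms of the resolution in the degrees from `a` to `b` are
built from the `A (e i)` with `i ∈ I`, then some `A (e c)` with `c ∈ I` no longer occurs in the
degrees from `a + d + 1` to `b`. Otherwise a socle element `v` of `V_I`, applied to a generator `p`
of a summand `A (e c)`, would give a cycle modulo the regular sequence, hence a boundary; as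
boundaries lie in `𝔪 ^ s`, this contradicts the choice of `c` and `v`. -/
theorem exists_idempotentSpan_erase_eq_top {R : Type*} [CommRing R] [IsLocalRing R]
    [IsNoetherianRing R] [IsAdicComplete (maximalIdeal R) R] {d : ℕ} (hd : ringKrullDim R = d)
    {A : Type*} [Ring A] [Algebra R A] [Module.Finite R A] {ι : Type*} [DecidableEq ι] {e : ι → A}
    (he : OrthogonalIdempotents e) (hprim : ∀ i, IsPrimitiveIdempotent (e i)) {I : Finset ι}
    {s₀ s : ℕ} (hs₀ : IsSocleNumber R (he.cornerFamily I) s₀) (hs : s₀ ≤ s)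
    {P : ℕ → Type*} [∀ n, AddCommGroup (P n)] [∀ n, Module R (P n)] [∀ n, Module A (P n)]
    [∀ n, IsScalarTower R A (P n)] [∀ n, Module.Projective A (P n)] [∀ n, Module.Finite A (P n)]
    (δ : ∀ n, P (n + 1) →ₗ[A] P n) (hδ : ∀ n, Function.Exact (δ (n + 1)) (δ n)) {a b : ℕ}
    (hδs : ∀ n ≤ b, ∀ p, δ n p ∈ maximalIdeal R ^ s • (⊤ : Submodule R (P n)))
    (hI : ∀ n, a ≤ n → n ≤ b → idempotentSpan e I (P n) = ⊤) :
    ∃ c ∈ I, ∀ n, a + d + 1 ≤ n → n ≤ b → idempotentSpan e (I.erase c) (P n) = ⊤ := by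
  have hε := he.sum_isIdempotent I
  set ε := ∑ i ∈ I, e i with hεdef
  have := Module.Finite.corner (R := R) hε
  obtain ⟨hs1, x, c, v, hreg, hv, hvc⟩ := hs₀.exists_notMem
  have hεc : ε * e c = e c := he.sum_mul_of_mem c.2
  refine ⟨c, c.2, fun n han hnb => ?_⟩
  obtain ⟨n, rfl⟩ : ∃ m, n = m + 1 := ⟨n - 1, by omega⟩
  by_contra hne
  obtain ⟨p, φ, hp, hφ⟩ := exists_dual_eq_idempotent (R := R) (hprim c) (hI _ (by omega) hnb) hne
  set 𝔞 := Ideal.ofList x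
  -- `v` annihilates `𝔪` modulo the sequence `x`
  have hvm : ∀ z ∈ maximalIdeal R • (⊤ : Submodule R (P n)),
      v.1 • z ∈ 𝔞 • (⊤ : Submodule R (P n)) := by
    intro z hz
    refine Submodule.smul_induction_on hz (fun r hr m _ => ?_) fun _ _ h h' => ?_
    · have h1 : r • v.1 ∈ 𝔞 • (⊤ : Submodule R A) :=
        Submodule.map_mem_smul_top (cornerInclusion hε) (hv r hr)
      have h2 : v.1 • r • m = (r • v.1) • m := by
        rw [smul_assoc, ← algebraMap_smul A r m, ← algebraMap_smul A r (v.1 • m), smul_smul,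
          smul_smul, Algebra.commutes]
      rw [h2]
      exact Submodule.map_mem_smul_top ((LinearMap.toSpanSingleton A _ m).restrictScalars R) h1
    · rw [smul_add]
      exact Submodule.add_mem _ h h'
  have hcycle : δ n (v.1 • p) ∈ 𝔞 • (⊤ : Submodule R (P n)) := by
    rw [map_smul]
    refine hvm _ (Submodule.smul_mono (Ideal.pow_le_self ?_) le_rfl (hδs n (by omega) p))
    omega
  have hlen := hreg.length_le hd
  obtain ⟨q, hq⟩ := exists_sub_mem_smul_top_of_isWeaklyRegular_corner hε hreg.toIsWeaklyRegular
    δ hδ (fun n h h' => he.span_fixed_eq_top (hI n h h')) (le_refl x.length)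
    (n := n) (q := v.1 • p) (by omega) hnb (by rw [smul_smul, mul_corner_coe])
    (by rwa [List.take_length])
  rw [List.take_length] at hq
  have hw : φ (δ (n + 1) q) ∈ maximalIdeal R ^ s₀ • (⊤ : Submodule R A) :=
    φ.map_mem_smul_top_of_isScalarTower
      (Submodule.smul_mono (Ideal.pow_le_pow_right hs) le_rfl (hδs (n + 1) hnb q))
  have hz := φ.map_mem_smul_top_of_isScalarTower hq
  set w := φ (δ (n + 1) q)
  set z := φ (v.1 • p - δ (n + 1) q) with hzdef
  refine hvc (cornerProjection hε w) (Submodule.map_mem_smul_top _ hw)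
    (cornerProjection hε (z * e c)) (Submodule.map_mem_smul_top _
      (Submodule.map_mem_smul_top (LinearMap.mulRight R (e c)) hz)) (Subtype.ext ?_)
  have hcε : e c * ε = e c := he.mul_sum_of_mem c.2
  change v.1 * e c = (ε * w * ε) * e c + ε * (z * e c) * ε
  have h1 : v.1 * e c = (w + z) * e c := by
    rw [hzdef, map_sub, add_sub_cancel, map_smul, smul_eq_mul, mul_assoc, hφ]
  calc v.1 * e c = ε * (v.1 * e c) := by rw [← mul_assoc, mul_corner_coe]
    _ = ε * w * e c + ε * (z * e c) := by rw [h1, add_mul, mul_add, mul_assoc]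
    _ = _ := by rw [mul_assoc (ε * w), hεc, mul_assoc ε (z * e c), mul_assoc z, hcε]

/-! ### Projective dimension -/

/-- A module with a projective resolution that vanishes in degree `N` has projective dimension less
than `N`. -/
theorem hasProjectiveDimensionLT_of_subsingleton {A : Type v} [Ring A] (N : ℕ) {U : Type v}
    [AddCommGroup U] [Module A U] {P : ℕ → Type v} [∀ n, AddCommGroup (P n)]
    [∀ n, Module A (P n)] [∀ n, Module.Projective A (P n)] (π : P 0 →ₗ[A] U)
    (hπ : Function.Surjective π) (δ : ∀ n, P (n + 1) →ₗ[A] P n)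
    (hδπ : Function.Exact (δ 0) π) (hδ : ∀ n, Function.Exact (δ (n + 1)) (δ n))
    [Subsingleton (P N)] : CategoryTheory.HasProjectiveDimensionLT (ModuleCat.of A U) N := by
  induction N generalizing U P with
  | zero =>
    have := hπ.subsingleton
    exact (ModuleCat.isZero_of_subsingleton (ModuleCat.of A U)).hasProjectiveDimensionLT_zero
  | succ N ih =>
    let π' : P 1 →ₗ[A] LinearMap.ker π :=
      (δ 0).codRestrict (LinearMap.ker π) fun p => (hδπ _).2 ⟨p, rfl⟩
    have h1 := ih (P := fun n => P (n + 1)) π'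
      (by
        rintro ⟨p, hp⟩
        obtain ⟨q, rfl⟩ := (hδπ p).1 hp
        exact ⟨q, rfl⟩)
      (fun n => δ (n + 1))
      (fun p => by
        rw [← hδ 0 p]
        exact Subtype.ext_iff)
      (fun n => hδ (n + 1))
    have h2 : CategoryTheory.Projective (ModuleCat.of A (P 0)) :=
      (IsProjective.iff_projective _).1 inferInstance
    have h3 := (CategoryTheory.projective_iff_hasProjectiveDimensionLT_one).1 h2
    exact (LinearMap.shortExact_shortComplexKer hπ).hasProjectiveDimensionLT_X₃ N h1
      (CategoryTheory.hasProjectiveDimensionLT_of_ge _ 1 (N + 1) (by omega))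

/-! ### The noncommutative Herzog–Koh–Lee theorem -/

theorem mainTheorem6 {R : Type u} [CommRing R] [IsDomain R] [IsLocalRing R] [IsNoetherianRing R]
    [IsAdicComplete (IsLocalRing.maximalIdeal R) R]
    (d : ℕ) (hd : ringKrullDim R = d)
    {Λ : Type v} [Ring Λ] [Algebra R Λ] [Module.Finite R Λ] [Module.IsTorsionFree R Λ]
    {l : ℕ} (e : Fin l → Λ) (he : IsBasicSet e)
    (sI : Finset (Fin l) → ℕ)
    (hsI : ∀ I : Finset (Fin l), I.Nonempty →
      IsSocleNumber R (he.ortho.cornerFamily I) (sI I))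
    (s : ℕ) (hs : s = (Finset.univ.filter fun I : Finset (Fin l) => I.Nonempty).sup sI)
    {U : Type v} [AddCommGroup U] [Module Λ U] [Module.Finite Λ U]
    {P : ℕ → Type v} [∀ n, AddCommGroup (P n)] [∀ n, Module R (P n)] [∀ n, Module Λ (P n)]
    [∀ n, IsScalarTower R Λ (P n)]
    (π : P 0 →ₗ[Λ] U) (δ : ∀ n, P (n + 1) →ₗ[Λ] P n)
    (hP : IsMinimalProjectiveResolution π δ)
    (hδ : ∀ j ≤ l * (d + 1), (LinearMap.range (δ j)).restrictScalars R ≤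
      IsLocalRing.maximalIdeal R ^ s • (⊤ : Submodule R (P j))) :
    Subsingleton (P (l * (d + 1))) ∧
      CategoryTheory.projectiveDimension (ModuleCat.of Λ U) < ((l * (d + 1) : ℕ) : WithBot ℕ∞) := by
  have := hP.projective
  have := hP.finite
  have : IsNoetherianRing Λ := isNoetherian_of_tower R inferInstance
  have key : ∀ k ≤ l, ∃ I : Finset (Fin l), I.card = l - k ∧
      ∀ n, k * (d + 1) ≤ n → n ≤ l * (d + 1) → idempotentSpan e I (P n) = ⊤ := by
    intro k
    induction k with
    | zero => exact fun _ => ⟨Finset.univ, by simp, fun n _ _ => he.idempotentSpan_eq_top (P n)⟩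
    | succ k ih =>
      intro hk
      obtain ⟨I, hcard, hI⟩ := ih (by omega)
      have hne : I.Nonempty := Finset.card_pos.1 (by omega)
      obtain ⟨c, hc, hcI⟩ := exists_idempotentSpan_erase_eq_top hd he.ortho he.primitive
        (hsI I hne) (hs ▸ Finset.le_sup (by simpa using hne)) δ hP.exact_succ
        (fun n hn p => hδ n hn ⟨p, rfl⟩) hI
      refine ⟨I.erase c, by rw [Finset.card_erase_of_mem hc]; omega, fun n hn => hcI n ?_⟩
      rwa [add_assoc, ← Nat.succ_mul]
  obtain ⟨I, hcard, hI⟩ := key l le_rfl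
  have hsub : Subsingleton (P (l * (d + 1))) := by
    obtain rfl : I = ∅ := Finset.card_eq_zero.1 (by omega)
    have h := hI _ le_rfl le_rfl
    rw [← Submodule.subsingleton_iff Λ, ← subsingleton_iff_bot_eq_top, ← h]
    simp [idempotentSpan]
  exact ⟨hsub, CategoryTheory.projectiveDimension_lt_iff.2
    (hasProjectiveDimensionLT_of_subsingleton _ π hP.surjective δ hP.exact_zero hP.exact_succ)⟩
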